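/- Let $X$ be a locale with frame of opens $\mathcal{O}(X)$, and let $U \in \mathcal{O}(X)$. A *formula over $U$* is an infinitary first-order formula without free variables, built using $=, \top, \wedge, \bigwedge, \bot, \vee, \bigvee, \Rightarrow, \forall, \exists$ (where $\bigwedge$ and $\bigvee$ range over arbitrary set-indexed families of formulas), over the signature which has one sort for each sheaf of sets $F$ on $X$, one constant symbol of sort $F$ for each section $s \in F(U)$, one function symbol for each morphism of sheaves $F_1 \times \cdots \times F_n \to G$, and one relation symbol for each subsheaf $R \subseteq F_1 \times \cdots \times F_n$. If $V \preceq U$, a formula over $U$ is regarded as a formula over $V$ by replacing each constant symbol $s \in F(U)$ by its restriction $s|_V \in F(V)$. The relation $U \models \varphi$ (sheaf semantics, or Kripke–Joyal semantics) is defined by recursion on $\varphi$; "covering" means a set-indexed family $(U_i)_i$ of opens with $U = \bigvee_i U_i$: - $U \models s =_F t$ iff $s = t$ in $F(U)$; - $U \models R(s_1,\ldots,s_n)$ iff $\langle s_1,\ldots,s_n\rangle \in R(U)$; - $U \models \top$ always; $U \models \bot$ iff $U = \bot$; - $U \models \varphi \wedge \psi$ iff $U \models \varphi$ and $U \models \psi$;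 $U \models \bigwedge_k \varphi_k$ iff $U \models \varphi_k$ for all $k$; - $U \models \varphi \vee \psi$ iff there is a covering $U = \bigvee_i U_i$ such that for each $i$, $U_i \models \varphi$ or $U_i \models \psi$; - $U \models \bigvee_k \varphi_k$ iff there is a covering $U = \bigvee_i U_i$ such that for each $i$ there is an index $k$ with $U_i \models \varphi_k$; - $U \models \varphi \Rightarrow \psi$ iff for all $V \preceq U$, $V \models \varphi$ implies $V \models \psi$; - $U \models \forall s{:}F.\ \varphi(s)$ iff for all $V \preceq U$ and all $s_0 \in F(V)$, $V \models \varphi(s_0)$; - $U \models \exists s{:}F.\ \varphi(s)$ iff there is a covering $U = \bigvee_i U_i$ such that for each $i$ there is $s_0 \in F(U_i)$ with $U_i \models \varphi(s_0)$. (Closed terms are evaluated in the evident way, applying the morphisms to the values of the arguments.) A formula $\varphi$ over $U$ *entails* a formula $\psi$ over $U$ *intuitionistically* if the sequent $\varphi \vdash \psi$ in the empty context is derivable in infinitary intuitionistic first-order logic over the above signature. This is the calculus of sequents $\varphi \vdash_{\vec x} \psi$ in finite contexts $\vec x$ of sorted variables, given by: identity, cut, and substitution of terms for variables; the usual introduction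 and elimination rules for $\top, \wedge, \bot, \vee$; for set-indexed families, $\varphi_{i_0} \vdash_{\vec x} \bigvee_i \varphi_i$ and $\bigwedge_i \varphi_i \vdash_{\vec x} \varphi_{i_0}$, from $\varphi_i \vdash_{\vec x} \chi$ for all $i$ infer $\bigvee_i \varphi_i \vdash_{\vec x} \chi$, and from $\psi \vdash_{\vec x} \varphi_i$ for all $i$ infer $\psi \vdash_{\vec x} \bigwedge_i \varphi_i$; the double rules ($\varphi \wedge \psi \vdash_{\vec x} \chi$ iff $\varphi \vdash_{\vec x} \psi \Rightarrow \chi$), ($\varphi \vdash_{\vec x, y} \psi$ iff $\exists y.\,\varphi \vdash_{\vec x} \psi$, for $y$ not free in $\psi$), and ($\varphi \vdash_{\vec x,y} \psi$ iff $\varphi \vdash_{\vec x} \forall y.\,\psi$, for $y$ not free in $\varphi$); the distributivity axioms $(\bigvee_i \varphi_i) \wedge \psi \vdash_{\vec x} \bigvee_i (\varphi_i \wedge \psi)$ and $(\exists y.\,\varphi) \wedge \psi \vdash_{\vec x} \exists y.\,(\varphi \wedge \psi)$ for $y$ not free in $\psi$; and the equality axioms $\top \vdash_x x = x$ and $(\vec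 x = \vec y) \wedge \varphi \vdash_{\vec z} \varphi[\vec y/\vec x]$. **Theorem.** Let $X$ be a locale, let $U$ be an open of $X$, and let $\varphi$ be a formula over $U$. 1. (Monotonicity) If $V$ is an open with $V \preceq U$, then $U \models \varphi$ implies $V \models \varphi$. 2. (Locality) Let $U = \bigvee_i U_i$ be an open covering. If $U_i \models \varphi$ for all $i$, then $U \models \varphi$. 3. (Soundness) Let $\psi$ be a further formula over $U$. If $U \models \varphi$ and if $\varphi$ entails $\psi$ intuitionistically, then $U \models \psi$. -/

import Mathlib

open CategoryTheory Opposite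

universe u v w x a b c d e

/-! ## Infinitary many-sorted first-order logic -/

namespace InfLogic

/-- A many-sorted first-order signature with set of sorts `S`: function symbols
`f : X₁ × ⋯ × Xₙ → Y` and relation symbols `R ↪ X₁ × ⋯ × Xₙ`. Constant symbols are kept in a
separate family `C : S → Type c`, so that one can change them while keeping the rest. -/
structure Signature (S : Type a) where
  Func : {n : ℕ} → (Fin n → S) → S → Type b
  Rel : {n : ℕ} → (Fin n → S) → Type d

/-- `Var Γ s`: the variables of sort `s` of the context `Γ` (a finite list of sorts, one for each
variable of the context). -/
inductive Var {S : Type a} : List S → S → Type a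
  | zero {Γ : List S} {s : S} : Var (s :: Γ) s
  | succ {Γ : List S} {s t : S} (v : Var Γ s) : Var (t :: Γ) s

section Formulas

variable {S : Type a}

/-- Terms of sort `s` in the context `Γ`. -/
inductive Term (L : Signature.{a, b, d} S) (C : S → Type c) (Γ : List S) : S → Type (max a b c)
  | var {s : S} (v : Var Γ s) : Term L C Γ s
  | const {s : S} (k : C s) : Term L C Γ s
  | app {n : ℕ} {dom : Fin n → S} {s : S} (f : L.Func dom s)
      (args : (i : Fin n) → Term L C Γ (dom i)) : Term L C Γ s

/-- Infinitary first-order formulas in the context `Γ`. The set-indexed conjunctions `⋀` and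
disjunctions `⋁` range over arbitrary families indexed by sets of `Type w`. -/
inductive Formula (L : Signature.{a, b, d} S) (C : S → Type c) :
    List S → Type (max a b c d (w + 1))
  | eq {Γ : List S} {s : S} (t₁ t₂ : Term L C Γ s) : Formula L C Γ
  | rel {Γ : List S} {n : ℕ} {dom : Fin n → S} (R : L.Rel dom)
      (args : (i : Fin n) → Term L C Γ (dom i)) : Formula L C Γ
  | top {Γ : List S} : Formula L C Γ
  | and {Γ : List S} (φ ψ : Formula L C Γ) : Formula L C Γ
  | bigAnd {Γ : List S} {I : Type w} (φ : I → Formula L C Γ) : Formula L C Γ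
  | bot {Γ : List S} : Formula L C Γ
  | or {Γ : List S} (φ ψ : Formula L C Γ) : Formula L C Γ
  | bigOr {Γ : List S} {I : Type w} (φ : I → Formula L C Γ) : Formula L C Γ
  | imp {Γ : List S} (φ ψ : Formula L C Γ) : Formula L C Γ
  | all {Γ : List S} (s : S) (φ : Formula L C (s :: Γ)) : Formula L C Γ
  | ex {Γ : List S} (s : S) (φ : Formula L C (s :: Γ)) : Formula L C Γ

variable {L : Signature.{a, b, d} S} {C : S → Type c} {C' : S → Type e}

/-- Substitution of terms `σ` for the variables of a term. -/
def Term.subst {Γ Δ : List S} (σ : (s : S) → Var Γ s → Term L C Δ s) :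
    {s : S} → Term L C Γ s → Term L C Δ s
  | _, .var v => σ _ v
  | _, .const k => .const k
  | _, .app f args => .app f (fun i => (args i).subst σ)

/-- The substitution `σ`, extended to one further (bound) variable which is kept fixed. -/
def liftSubst {Γ Δ : List S} (σ : (s : S) → Var Γ s → Term L C Δ s) (t : S) :
    (s : S) → Var (t :: Γ) s → Term L C (t :: Δ) s
  | _, .zero => .var .zero
  | _, .succ v => (σ _ v).subst (fun _ v => .var v.succ)

/-- Simultaneous capture-avoiding substitution `φ[σ]`. -/
def Formula.subst : {Γ Δ : List S} → ((s : S) → Var Γ s → Term L C Δ s) →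
    Formula.{w} L C Γ → Formula.{w} L C Δ
  | _, _, σ, .eq t₁ t₂ => .eq (t₁.subst σ) (t₂.subst σ)
  | _, _, σ, .rel R args => .rel R (fun i => (args i).subst σ)
  | _, _, _, .top => .top
  | _, _, σ, .and φ ψ => .and (φ.subst σ) (ψ.subst σ)
  | _, _, σ, .bigAnd φ => .bigAnd (fun i => (φ i).subst σ)
  | _, _, _, .bot => .bot
  | _, _, σ, .or φ ψ => .or (φ.subst σ) (ψ.subst σ)
  | _, _, σ, .bigOr φ => .bigOr (fun i => (φ i).subst σ)
  | _, _, σ, .imp φ ψ => .imp (φ.subst σ) (ψ.subst σ)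
  | _, _, σ, .all s φ => .all s (φ.subst (liftSubst σ s))
  | _, _, σ, .ex s φ => .ex s (φ.subst (liftSubst σ s))

/-- A formula in the context `Γ`, regarded as a formula in the context `Γ, y : t` (in which `y` is
not free). -/
def Formula.weaken {Γ : List S} (t : S) (φ : Formula.{w} L C Γ) : Formula.{w} L C (t :: Γ) :=
  φ.subst (fun _ v => .var v.succ)

/-- Replacing each variable `v` by the variable `ρ v`. -/
def Formula.rename {Γ Δ : List S} (ρ : (s : S) → Var Γ s → Var Δ s) (φ : Formula.{w} L C Γ) :
    Formula.{w} L C Δ :=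
  φ.subst (fun s v => .var (ρ s v))

/-- Replacing the constant symbols of a term along `g`. -/
def Term.mapConst {Γ : List S} (g : (s : S) → C s → C' s) :
    {s : S} → Term L C Γ s → Term L C' Γ s
  | _, .var v => .var v
  | _, .const k => .const (g _ k)
  | _, .app f args => .app f (fun i => (args i).mapConst g)

/-- Replacing the constant symbols of a formula along `g`. -/
def Formula.mapConst (g : (s : S) → C s → C' s) :
    {Γ : List S} → Formula.{w} L C Γ → Formula.{w} L C' Γ
  | _, .eq t₁ t₂ => .eq (t₁.mapConst g) (t₂.mapConst g)
  | _, .rel R args => .rel R (fun i => (args i).mapConst g)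
  | _, .top => .top
  | _, .and φ ψ => .and (φ.mapConst g) (ψ.mapConst g)
  | _, .bigAnd φ => .bigAnd (fun i => (φ i).mapConst g)
  | _, .bot => .bot
  | _, .or φ ψ => .or (φ.mapConst g) (ψ.mapConst g)
  | _, .bigOr φ => .bigOr (fun i => (φ i).mapConst g)
  | _, .imp φ ψ => .imp (φ.mapConst g) (ψ.mapConst g)
  | _, .all s φ => .all s (φ.mapConst g)
  | _, .ex s φ => .ex s (φ.mapConst g)

/-- The conjunction `x₁ = ρ x₁ ∧ (⋯ ∧ (xₙ = ρ xₙ ∧ ⊤))` over a list `x₁, …, xₙ` of variables. -/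
def eqConj {Γ : List S} (ρ : (s : S) → Var Γ s → Var Γ s) :
    List ((s : S) × Var Γ s) → Formula.{w} L C Γ
  | [] => .top
  | x :: xs => .and (.eq (.var x.2) (.var (ρ _ x.2))) (eqConj ρ xs)

/-- `Entails φ ψ`: the sequent `φ ⊢ ψ` in the context `Γ` is derivable in infinitary
intuitionistic first-order logic (without non-logical axioms). -/
inductive Entails : {Γ : List S} → Formula.{w} L C Γ → Formula.{w} L C Γ → Prop
  -- structural rules
  | refl {Γ : List S} (φ : Formula L C Γ) : Entails φ φ
  | cut {Γ : List S} {φ ψ χ : Formula L C Γ} : Entails φ ψ → Entails ψ χ → Entails φ χ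
  | subst {Γ Δ : List S} {φ ψ : Formula L C Γ} (σ : (s : S) → Var Γ s → Term L C Δ s) :
      Entails φ ψ → Entails (φ.subst σ) (ψ.subst σ)
  -- conjunction
  | top_intro {Γ : List S} (φ : Formula L C Γ) : Entails φ .top
  | and_left {Γ : List S} (φ ψ : Formula L C Γ) : Entails (φ.and ψ) φ
  | and_right {Γ : List S} (φ ψ : Formula L C Γ) : Entails (φ.and ψ) ψ
  | and_intro {Γ : List S} {φ ψ χ : Formula L C Γ} :
      Entails φ ψ → Entails φ χ → Entails φ (ψ.and χ)
  -- finitary disjunction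
  | bot_elim {Γ : List S} (φ : Formula L C Γ) : Entails .bot φ
  | or_left {Γ : List S} (φ ψ : Formula L C Γ) : Entails φ (φ.or ψ)
  | or_right {Γ : List S} (φ ψ : Formula L C Γ) : Entails ψ (φ.or ψ)
  | or_elim {Γ : List S} {φ ψ χ : Formula L C Γ} :
      Entails φ χ → Entails ψ χ → Entails (φ.or ψ) χ
  -- infinitary disjunction
  | bigOr_intro {Γ : List S} {I : Type w} (φ : I → Formula L C Γ) (i : I) :
      Entails (φ i) (.bigOr φ)
  | bigOr_elim {Γ : List S} {I : Type w} {φ : I → Formula L C Γ} {χ : Formula L C Γ} :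
      (∀ i, Entails (φ i) χ) → Entails (.bigOr φ) χ
  -- existential quantification (double rule)
  | ex_elim {Γ : List S} {s : S} {φ : Formula L C (s :: Γ)} {ψ : Formula L C Γ} :
      Entails φ (ψ.weaken s) → Entails (.ex s φ) ψ
  | ex_elim_inv {Γ : List S} {s : S} {φ : Formula L C (s :: Γ)} {ψ : Formula L C Γ} :
      Entails (.ex s φ) ψ → Entails φ (ψ.weaken s)
  -- mixed rules
  | bigOr_and {Γ : List S} {I : Type w} (φ : I → Formula L C Γ) (ψ : Formula L C Γ) :
      Entails ((Formula.bigOr φ).and ψ) (.bigOr fun i => (φ i).and ψ)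
  | ex_and {Γ : List S} {s : S} (φ : Formula L C (s :: Γ)) (ψ : Formula L C Γ) :
      Entails ((Formula.ex s φ).and ψ) (.ex s (φ.and (ψ.weaken s)))
  -- equality; in the second rule, `ρ` is the replacement of variables `[y₁/x₁, …, yₙ/xₙ]`
  | eq_refl (s : S) : Entails (Γ := [s]) .top (.eq (.var .zero) (.var .zero))
  | eq_subst {Γ : List S} (ρ : (s : S) → Var Γ s → Var Γ s) (xs : List ((s : S) × Var Γ s))
      (hρ : ∀ (s : S) (v : Var Γ s), (⟨s, v⟩ : (s : S) × Var Γ s) ∉ xs → ρ s v = v)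
      (φ : Formula L C Γ) : Entails ((eqConj ρ xs).and φ) (φ.rename ρ)
  -- infinitary conjunction
  | bigAnd_elim {Γ : List S} {I : Type w} (φ : I → Formula L C Γ) (i : I) :
      Entails (.bigAnd φ) (φ i)
  | bigAnd_intro {Γ : List S} {I : Type w} {ψ : Formula L C Γ} {φ : I → Formula L C Γ} :
      (∀ i, Entails ψ (φ i)) → Entails ψ (.bigAnd φ)
  -- implication (double rule)
  | imp_intro {Γ : List S} {φ ψ χ : Formula L C Γ} : Entails (φ.and ψ) χ → Entails φ (ψ.imp χ)
  | imp_elim {Γ : List S} {φ ψ χ : Formula L C Γ} : Entails φ (ψ.imp χ) → Entails (φ.and ψ) χ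
  -- universal quantification (double rule)
  | all_intro {Γ : List S} {s : S} {φ : Formula L C Γ} {ψ : Formula L C (s :: Γ)} :
      Entails (φ.weaken s) ψ → Entails φ (.all s ψ)
  | all_elim {Γ : List S} {s : S} {φ : Formula L C Γ} {ψ : Formula L C (s :: Γ)} :
      Entails φ (.all s ψ) → Entails (φ.weaken s) ψ

end Formulas

end InfLogic

/-! ## Sheaves on a locale, given by its frame `O` of opens -/

namespace LocaleSheaf

section Sheaves

variable {O : Type u} [Order.Frame O]

theorem le_of_cover {U : O} {ι : Type x} {c : ι → O} (hc : U = ⨆ i, c i) (i : ι) : c i ≤ U :=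
  hc ▸ le_iSup c i

/-- Restriction `s|ᵁ_V` of a section of a presheaf. -/
abbrev pres (P : Oᵒᵖ ⥤ Type v) {V U : O} (h : V ≤ U) (s : P.obj (op U)) : P.obj (op V) :=
  P.map (homOfLE h).op s

/-- The sheaf condition: for every open covering `U = ⋁ᵢ Uᵢ`, compatible families of sections
glue uniquely. -/
def IsSheaf (P : Oᵒᵖ ⥤ Type v) : Prop :=
  ∀ (U : O) (ι : Type u) (c : ι → O) (hc : U = ⨆ i, c i) (s : (i : ι) → P.obj (op (c i))),
    (∀ i j, pres P (inf_le_left : c i ⊓ c j ≤ c i) (s i) =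
      pres P (inf_le_right : c i ⊓ c j ≤ c j) (s j)) →
    ∃! t : P.obj (op U), ∀ i, pres P (le_of_cover hc i) t = s i

variable (O) in
/-- Sheaves (of sets) on the locale with frame of opens `O`. -/
structure Sheaf where
  presheaf : Oᵒᵖ ⥤ Type v
  isSheaf : IsSheaf presheaf

/-- The set `F(U)` of sections. -/
abbrev Sheaf.sec (F : Sheaf.{u, v} O) (U : O) : Type v := F.presheaf.obj (op U)

/-- The restriction map `F(U) → F(V)`. -/
abbrev Sheaf.res (F : Sheaf.{u, v} O) {V U : O} (h : V ≤ U) : F.sec U → F.sec V :=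
  pres F.presheaf h

/-- The presheaf `F₁ × ⋯ × Fₙ`. -/
def prodPresheaf {n : ℕ} (F : Fin n → Sheaf.{u, v} O) : Oᵒᵖ ⥤ Type v where
  obj U := (i : Fin n) → (F i).presheaf.obj U
  map f := TypeCat.ofHom fun s i => (F i).presheaf.map f (s i)

/-- The product sheaf `F₁ × ⋯ × Fₙ` (for `n = 0`, the terminal sheaf). -/
def Sheaf.prod {n : ℕ} (F : Fin n → Sheaf.{u, v} O) : Sheaf.{u, v} O where
  presheaf := prodPresheaf F
  isSheaf := by
    intro U ι c hc s hs
    have h : ∀ k : Fin n, ∃! t : (F k).sec U,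
        ∀ i, (F k).res (le_of_cover hc i) t = s i k :=
      fun k => (F k).isSheaf U ι c hc (fun i => s i k) (fun i j => congrFun (hs i j) k)
    choose t ht using h
    refine ⟨t, fun i => funext fun k => (ht k).1 i, fun t' ht' => funext fun k => ?_⟩
    exact (ht k).2 (t' k) (fun i => congrFun (ht' i) k)

/-- A subsheaf of `F`: a subpresheaf which is itself a sheaf. -/
structure Subsheaf (F : Sheaf.{u, v} O) where
  sub : Subfunctor F.presheaf
  isSheaf : IsSheaf sub.toFunctor

end Sheaves

/-! ## Sheaf semantics -/

section Semantics

open InfLogic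

variable {O : Type u} [Order.Frame O]

variable (O) in
/-- The signature of the sheaf semantics, without its constant symbols: one sort for each sheaf,
one function symbol for each morphism of sheaves `F₁ × ⋯ × Fₙ → G`, one relation symbol for each
subsheaf `R ⊆ F₁ × ⋯ × Fₙ`. -/
def sheafSignature : Signature.{max u (v + 1), max u v, max u v} (Sheaf.{u, v} O) where
  Func F G := (Sheaf.prod F).presheaf ⟶ G.presheaf
  Rel F := Subsheaf (Sheaf.prod F)

/-- Formulas over `U` with free variables in `Γ`: for each sheaf `F`, the constant symbols of sort
`F` are the sections `s ∈ F(U)`. -/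
abbrev OpenFormula (U : O) (Γ : List (Sheaf.{u, v} O)) : Type (max u (v + 1) (w + 1)) :=
  Formula.{w} (sheafSignature.{u, v} O) (fun F => F.sec U) Γ

/-- Formulas over `U` (without free variables). -/
abbrev FormulaOver (U : O) : Type (max u (v + 1) (w + 1)) :=
  OpenFormula.{u, v, w} U []

/-- A formula over `U` as a formula over `V ≤ U`: each constant symbol `s ∈ F(U)` is replaced by
its restriction `s|ᵁ_V ∈ F(V)`. -/
def _root_.InfLogic.Formula.restrict {U V : O} {Γ : List (Sheaf.{u, v} O)}
    (φ : OpenFormula.{u, v, w} U Γ) (h : V ≤ U) : OpenFormula.{u, v, w} V Γ :=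
  φ.mapConst (fun F => F.res h)

/-- Values in sections over `V` for the variables of `Γ`. -/
abbrev Env (V : O) (Γ : List (Sheaf.{u, v} O)) : Type (max u (v + 1)) :=
  (F : Sheaf.{u, v} O) → Var Γ F → F.sec V

/-- The environment of the empty context. -/
def Env.nil {V : O} : Env.{u, v} V [] := fun _ v => nomatch v

/-- Restriction of an environment. -/
def Env.res {V W : O} {Γ : List (Sheaf.{u, v} O)} (h : W ≤ V) (ρ : Env V Γ) : Env W Γ :=
  fun F v => F.res h (ρ F v)

/-- Extension of an environment by a value `s₀` for one further variable. -/
def Env.cons {V : O} {Γ : List (Sheaf.{u, v} O)} {G : Sheaf.{u, v} O} (s₀ : G.sec V)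
    (ρ : Env V Γ) : Env V (G :: Γ)
  | _, .zero => s₀
  | _, .succ v => ρ _ v

/-- The value over `V ≤ U` of a term over `U`; constants `s ∈ F(U)` are restricted to `V`. -/
def eval {U V : O} (h : V ≤ U) {Γ : List (Sheaf.{u, v} O)} (ρ : Env V Γ) :
    {F : Sheaf.{u, v} O} →
      Term (sheafSignature.{u, v} O) (fun F => F.sec U) Γ F → F.sec V
  | _, .var v => ρ _ v
  | F, .const s => F.res h s
  | F, .app (dom := dom) f args =>
      NatTrans.app (F := (Sheaf.prod dom).presheaf) (G := F.presheaf) f (op V)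
        (fun i => eval h ρ (args i) : (i : Fin _) → (dom i).sec V)

/-- The forcing relation `V ⊨ φ(ρ)` for a formula `φ` over `U`, an open `V ≤ U`, and values `ρ` in
sections over `V` for the free variables of `φ`, by recursion on `φ`. -/
def ForcesAt {U : O} : {Γ : List (Sheaf.{u, v} O)} → OpenFormula.{u, v, w} U Γ →
    (V : O) → V ≤ U → Env V Γ → Prop
  | _, .eq t₁ t₂, _, h, ρ => eval h ρ t₁ = eval h ρ t₂
  | _, .rel (dom := dom) R args, V, h, ρ =>
      (fun i => eval h ρ (args i) : (i : Fin _) → (dom i).sec V) ∈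
        (Subsheaf.sub (F := Sheaf.prod dom) R).obj (op V)
  | _, .top, _, _, _ => True
  | _, .and φ ψ, V, h, ρ => ForcesAt φ V h ρ ∧ ForcesAt ψ V h ρ
  | _, .bigAnd φ, V, h, ρ => ∀ k, ForcesAt (φ k) V h ρ
  | _, .bot, V, _, _ => V = ⊥
  | _, .or φ ψ, V, h, ρ => ∃ (ι : Type u) (c : ι → O) (hc : V = ⨆ i, c i), ∀ i,
      ForcesAt φ (c i) ((le_of_cover hc i).trans h) (ρ.res (le_of_cover hc i)) ∨
        ForcesAt ψ (c i) ((le_of_cover hc i).trans h) (ρ.res (le_of_cover hc i))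
  | _, .bigOr φ, V, h, ρ => ∃ (ι : Type u) (c : ι → O) (hc : V = ⨆ i, c i), ∀ i,
      ∃ k, ForcesAt (φ k) (c i) ((le_of_cover hc i).trans h) (ρ.res (le_of_cover hc i))
  | _, .imp φ ψ, V, h, ρ => ∀ (W : O) (hW : W ≤ V),
      ForcesAt φ W (hW.trans h) (ρ.res hW) → ForcesAt ψ W (hW.trans h) (ρ.res hW)
  | _, .all F φ, V, h, ρ => ∀ (W : O) (hW : W ≤ V) (s₀ : F.sec W),
      ForcesAt φ W (hW.trans h) ((ρ.res hW).cons s₀)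
  | _, .ex F φ, V, h, ρ => ∃ (ι : Type u) (c : ι → O) (hc : V = ⨆ i, c i), ∀ i,
      ∃ s₀ : F.sec (c i),
        ForcesAt φ (c i) ((le_of_cover hc i).trans h) ((ρ.res (le_of_cover hc i)).cons s₀)

/-- The sheaf semantics `U ⊨ φ` of a formula `φ` over `U`. -/
def Forces (U : O) (φ : FormulaOver.{u, v, w} U) : Prop :=
  ForcesAt φ U le_rfl Env.nil

end Semantics

end LocaleSheaf

/-! Forcing behaves like a subsheaf: passing to smaller opens preserves it (`ForcesAt.mono`), and so
does gluing along coverings (`ForcesAt.of_cover`). Both are inductions on the formula, for all opens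
and environments at once. Atoms use naturality, separatedness and the sheaf condition on relations.
The clauses for disjunctions and `∃` carry a covering, and coverings can be cut down and composed.
Those for `⇒` and `∀` quantify over smaller opens; their locality comes from cutting the covering
down by frame distributivity.

Soundness (`ForcesAt.of_entails`) is an induction on derivations. Eliminating `⊥`, disjunctions or
`∃` is locality of the conclusion; introducing `⇒` or `∀` is monotonicity of the premise; variables
are handled by `forcesAt_subst`. Finally, `forcesAt_restrict` identifies restricting the constants
of a closed formula with evaluating it at a smaller open. -/

namespace LocaleSheaf

open InfLogic

/-! ### Coverings and local truth -/

section Covers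

variable {O : Type u} [Order.Frame O]

theorem cover_inf {V W : O} (hW : W ≤ V) {ι : Type x} {c : ι → O} (hc : V = ⨆ i, c i) :
    W = ⨆ i, W ⊓ c i := by
  rw [← inf_iSup_eq, ← hc, inf_eq_left.2 hW]

/-- `P` holds on the members of some open covering of `V`. -/
def HoldsLocally (V : O) (P : (W : O) → W ≤ V → Prop) : Prop :=
  ∃ (ι : Type u) (c : ι → O) (hc : V = ⨆ i, c i), ∀ i, P (c i) (le_of_cover hc i)

theorem HoldsLocally.of_self {V : O} {P : (W : O) → W ≤ V → Prop} (h : P V le_rfl) :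
    HoldsLocally V P :=
  ⟨PUnit, fun _ => V, by simp, fun _ => h⟩

theorem HoldsLocally.imp {V : O} {P Q : (W : O) → W ≤ V → Prop} (h : HoldsLocally V P)
    (hPQ : ∀ W hW, P W hW → Q W hW) : HoldsLocally V Q := by
  obtain ⟨ι, c, hc, hP⟩ := h
  exact ⟨ι, c, hc, fun i => hPQ _ _ (hP i)⟩

/-- Monotonicity of `P` is needed because the new covering consists of the smaller opens `W ⊓ c i`.
-/
theorem HoldsLocally.restrict {V W : O} {P : (W : O) → W ≤ V → Prop} (h : HoldsLocally V P)
    (hP : ∀ (W W' : O) (hW : W ≤ V) (hW' : W' ≤ W), P W hW → P W' (hW'.trans hW))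
    (hW : W ≤ V) : HoldsLocally W (fun W' h' => P W' (h'.trans hW)) := by
  obtain ⟨ι, c, hc, h⟩ := h
  exact ⟨ι, fun i => W ⊓ c i, cover_inf hW hc, fun i => hP _ _ _ inf_le_right (h i)⟩

/-- Coverings of the members of a covering combine, over a sigma type, into one covering. -/
theorem HoldsLocally.of_cover {V : O} {P : (W : O) → W ≤ V → Prop} {ι : Type u} {c : ι → O}
    (hc : V = ⨆ i, c i)
    (h : ∀ i, HoldsLocally (c i) (fun W hW => P W (hW.trans (le_of_cover hc i)))) :
    HoldsLocally V P := by
  choose κ d hd hP using h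
  refine ⟨Σ i, κ i, fun p => d p.1 p.2, ?_, fun p => hP p.1 p.2⟩
  rw [iSup_sigma, hc]
  exact iSup_congr hd

end Covers

/-! ### Sections of sheaves and subsheaves -/

section Sections

variable {O : Type u} [Order.Frame O]

theorem pres_pres (P : Oᵒᵖ ⥤ Type v) {V W W' : O} (h : W ≤ V) (h' : W' ≤ W) (s : P.obj (op V)) :
    pres P h' (pres P h s) = pres P (h'.trans h) s := by
  simp only [pres, ← Functor.map_comp_apply]
  rfl

theorem pres_rfl (P : Oᵒᵖ ⥤ Type v) {V : O} (s : P.obj (op V)) :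
    pres P (le_refl V) s = s :=
  Functor.map_id_apply P _ s

theorem IsSheaf.ext {P : Oᵒᵖ ⥤ Type v} (hP : IsSheaf P) {V : O} {ι : Type u} {c : ι → O}
    (hc : V = ⨆ i, c i) {s t : P.obj (op V)}
    (h : ∀ i, pres P (le_of_cover hc i) s = pres P (le_of_cover hc i) t) : s = t := by
  refine (hP V ι c hc (fun i => pres P (le_of_cover hc i) t) fun i j => ?_).unique h
    fun _ => rfl
  rw [pres_pres, pres_pres]

/-- The restrictions of `s` glue inside `R`; by separatedness of `F` the result is `s` itself. -/
theorem Subsheaf.mem_of_cover {F : Sheaf.{u, v} O} (R : Subsheaf F) {V : O} {ι : Type u}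
    {c : ι → O} (hc : V = ⨆ i, c i) {s : F.sec V}
    (h : ∀ i, F.res (le_of_cover hc i) s ∈ R.sub.obj (op (c i))) : s ∈ R.sub.obj (op V) := by
  obtain ⟨t, ht, -⟩ := R.isSheaf V ι c hc (fun i => ⟨F.res (le_of_cover hc i) s, h i⟩)
    fun i j => Subtype.ext <| by
      change pres F.presheaf _ (pres F.presheaf _ s) = pres F.presheaf _ (pres F.presheaf _ s)
      rw [pres_pres, pres_pres]
  have hst : s = t.1 := F.isSheaf.ext hc fun i => (congrArg Subtype.val (ht i)).symm
  rw [hst]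
  exact t.2

end Sections

/-! ### Environments, terms, and the forcing relation -/

section Semantics

variable {O : Type u} [Order.Frame O] {Γ Δ : List (Sheaf.{u, v} O)}

theorem Env.ext_cons {V : O} {G : Sheaf.{u, v} O} {ρ ρ' : Env V (G :: Γ)}
    (h₀ : ρ G .zero = ρ' G .zero) (h : ∀ F v, ρ F (.succ v) = ρ' F (.succ v)) : ρ = ρ' := by
  funext F v
  cases v with
  | zero => exact h₀
  | succ v => exact h _ v

theorem Env.eq_nil {V : O} (ρ : Env.{u, v} V []) : ρ = Env.nil := by
  funext F v
  nomatch v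

theorem Env.res_res {V W W' : O} (h : W ≤ V) (h' : W' ≤ W) (ρ : Env V Γ) :
    (ρ.res h).res h' = ρ.res (h'.trans h) := by
  funext F v
  exact pres_pres _ h h' _

theorem Env.res_rfl {V : O} (ρ : Env V Γ) : ρ.res le_rfl = ρ := by
  funext F v
  exact pres_rfl _ _

theorem Env.res_cons {V W : O} {G : Sheaf.{u, v} O} (h : W ≤ V) (s : G.sec V) (ρ : Env V Γ) :
    (ρ.cons s).res h = (ρ.res h).cons (G.res h s) :=
  Env.ext_cons rfl fun _ _ => rfl

theorem res_eval {U V W : O} (h : V ≤ U) (hW : W ≤ V) (ρ : Env V Γ) {F : Sheaf.{u, v} O}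
    (t : Term (sheafSignature.{u, v} O) (fun F => F.sec U) Γ F) :
    F.res hW (eval h ρ t) = eval (hW.trans h) (ρ.res hW) t := by
  induction t with
  | var v => rfl
  | const s => exact pres_pres _ h hW s
  | @app n dom F f args ih =>
    simp only [eval, ← ih]
    exact (NatTrans.naturality_apply (F := (Sheaf.prod dom).presheaf) (G := F.presheaf) f
      (homOfLE hW).op _).symm

theorem res_eval_tuple {U V W : O} (h : V ≤ U) (hW : W ≤ V) (ρ : Env V Γ) {n : ℕ}
    {dom : Fin n → Sheaf.{u, v} O}
    (args : (i : Fin n) → Term (sheafSignature.{u, v} O) (fun F => F.sec U) Γ (dom i)) :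
    (Sheaf.prod dom).res hW (fun i => eval h ρ (args i)) =
      (fun i => eval (hW.trans h) (ρ.res hW) (args i) : (i : Fin n) → (dom i).sec W) :=
  funext fun i => res_eval h hW ρ (args i)

theorem eval_subst {U V : O} (h : V ≤ U) (ρ : Env V Δ) {F : Sheaf.{u, v} O}
    (σ : (F : Sheaf.{u, v} O) → Var Γ F →
      Term (sheafSignature.{u, v} O) (fun F => F.sec U) Δ F)
    (t : Term (sheafSignature.{u, v} O) (fun F => F.sec U) Γ F) :
    eval h ρ (t.subst σ) = eval h (fun _ v => eval h ρ (σ _ v)) t := by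
  induction t with
  | var v => rfl
  | const s => rfl
  | app f args ih => simp only [Term.subst, eval, ih]

theorem eval_mapConst {U V W : O} (h : V ≤ U) (hW : W ≤ V) (ρ : Env W Γ) {F : Sheaf.{u, v} O}
    (t : Term (sheafSignature.{u, v} O) (fun F => F.sec U) Γ F) :
    eval hW ρ (t.mapConst (fun F => F.res h)) = eval (hW.trans h) ρ t := by
  induction t with
  | var v => rfl
  | const s => exact pres_pres _ h hW s
  | app f args ih => simp only [Term.mapConst, eval, ih]

/-- This and the next two lemmas expose the coverings in the clauses, so that the calculus of
`HoldsLocally` applies. -/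
theorem forcesAt_or {U V : O} {h : V ≤ U} {φ ψ : OpenFormula.{u, v, w} U Γ} {ρ : Env V Γ} :
    ForcesAt (φ.or ψ) V h ρ ↔ HoldsLocally V fun W hW =>
      ForcesAt φ W (hW.trans h) (ρ.res hW) ∨ ForcesAt ψ W (hW.trans h) (ρ.res hW) :=
  Iff.rfl

theorem forcesAt_bigOr {U V : O} {h : V ≤ U} {I : Type w} {φ : I → OpenFormula.{u, v, w} U Γ}
    {ρ : Env V Γ} : ForcesAt (.bigOr φ) V h ρ ↔ HoldsLocally V fun W hW =>
      ∃ k, ForcesAt (φ k) W (hW.trans h) (ρ.res hW) :=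
  Iff.rfl

theorem forcesAt_ex {U V : O} {h : V ≤ U} {F : Sheaf.{u, v} O}
    {φ : OpenFormula.{u, v, w} U (F :: Γ)} {ρ : Env V Γ} :
    ForcesAt (.ex F φ) V h ρ ↔ HoldsLocally V fun W hW =>
      ∃ s : F.sec W, ForcesAt φ W (hW.trans h) ((ρ.res hW).cons s) :=
  Iff.rfl

theorem forcesAt_restrict {U V W : O} (h : V ≤ U) (hW : W ≤ V) (φ : OpenFormula.{u, v, w} U Γ)
    (ρ : Env W Γ) : ForcesAt (φ.restrict h) W hW ρ ↔ ForcesAt φ W (hW.trans h) ρ := by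
  unfold Formula.restrict
  induction φ generalizing W with
  | eq | rel => simp only [Formula.mapConst, ForcesAt, eval_mapConst]
  | top | bot => rfl
  | and φ ψ ih₁ ih₂ | or φ ψ ih₁ ih₂ | imp φ ψ ih₁ ih₂ =>
    simp only [Formula.mapConst, ForcesAt, ih₁, ih₂]
  | bigAnd φ ih | bigOr φ ih | all F φ ih | ex F φ ih =>
    simp only [Formula.mapConst, ForcesAt, ih]

theorem ForcesAt.mono {U V W : O} {h : V ≤ U} {φ : OpenFormula.{u, v, w} U Γ} {ρ : Env V Γ}
    (hφ : ForcesAt φ V h ρ) (hW : W ≤ V) : ForcesAt φ W (hW.trans h) (ρ.res hW) := by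
  induction φ generalizing V W with
  | eq t₁ t₂ =>
    simp only [ForcesAt] at hφ ⊢
    rw [← res_eval h hW, ← res_eval h hW, hφ]
  | @rel Γ n dom R args =>
    simp only [ForcesAt, ← res_eval_tuple h hW] at hφ ⊢
    exact (Subsheaf.sub (F := Sheaf.prod dom) R).map (homOfLE hW).op hφ
  | top => trivial
  | bot =>
    simp only [ForcesAt] at hφ ⊢
    exact le_bot_iff.1 (hφ ▸ hW)
  | and φ ψ ih₁ ih₂ => exact ⟨ih₁ hφ.1 hW, ih₂ hφ.2 hW⟩
  | bigAnd φ ih => exact fun k => ih k (hφ k) hW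
  | or φ ψ ih₁ ih₂ =>
    refine forcesAt_or.2 <| ((forcesAt_or.1 hφ).restrict ?_ hW).imp ?_
    · rintro W W' hW hW' (h | h)
      · exact .inl (Env.res_res hW hW' ρ ▸ ih₁ h hW')
      · exact .inr (Env.res_res hW hW' ρ ▸ ih₂ h hW')
    · intro W' hW' h
      rwa [Env.res_res]
  | bigOr φ ih =>
    refine forcesAt_bigOr.2 <| ((forcesAt_bigOr.1 hφ).restrict ?_ hW).imp ?_
    · rintro W W' hW hW' ⟨k, h⟩
      exact ⟨k, Env.res_res hW hW' ρ ▸ ih k h hW'⟩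
    · intro W' hW' h
      rwa [Env.res_res]
  | imp φ ψ ih₁ ih₂ =>
    intro W' hW'
    rw [Env.res_res]
    exact hφ W' (hW'.trans hW)
  | all F φ ih =>
    intro W' hW' s
    rw [Env.res_res]
    exact hφ W' (hW'.trans hW) s
  | ex F φ ih =>
    refine forcesAt_ex.2 <| ((forcesAt_ex.1 hφ).restrict ?_ hW).imp ?_
    · rintro W W' hW hW' ⟨s, h⟩
      refine ⟨F.res hW' s, ?_⟩
      rw [← Env.res_res hW hW' ρ, ← Env.res_cons]
      exact ih h hW'
    · intro W' hW' h
      rwa [Env.res_res]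

theorem ForcesAt.of_cover {U V : O} {h : V ≤ U} {φ : OpenFormula.{u, v, w} U Γ} {ρ : Env V Γ}
    {ι : Type u} {c : ι → O} (hc : V = ⨆ i, c i)
    (hφ : ∀ i, ForcesAt φ (c i) ((le_of_cover hc i).trans h) (ρ.res (le_of_cover hc i))) :
    ForcesAt φ V h ρ := by
  induction φ generalizing V ι with
  | @eq Γ F t₁ t₂ =>
    refine F.isSheaf.ext hc fun i => ?_
    exact (res_eval h _ ρ t₁).trans ((hφ i).trans (res_eval h _ ρ t₂).symm)
  | @rel Γ n dom R args =>
    refine Subsheaf.mem_of_cover (F := Sheaf.prod dom) R hc fun i => ?_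
    rw [res_eval_tuple]
    exact hφ i
  | top => trivial
  | bot => exact hc.trans (iSup_eq_bot.2 hφ)
  | and φ ψ ih₁ ih₂ => exact ⟨ih₁ hc fun i => (hφ i).1, ih₂ hc fun i => (hφ i).2⟩
  | bigAnd φ ih => exact fun k => ih k hc fun i => hφ i k
  | or φ ψ ih₁ ih₂ =>
    refine forcesAt_or.2 <| .of_cover hc fun i => ?_
    simpa only [Env.res_res] using forcesAt_or.1 (hφ i)
  | bigOr φ ih =>
    refine forcesAt_bigOr.2 <| .of_cover hc fun i => ?_
    simpa only [Env.res_res] using forcesAt_bigOr.1 (hφ i)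
  | imp φ ψ ih₁ ih₂ =>
    intro W hW hW₁
    -- The conclusion is local, so it suffices on each `W ⊓ c i`, where the premise holds by
    -- monotonicity.
    refine ih₂ (cover_inf hW hc) fun i => ?_
    have := hφ i (W ⊓ c i) inf_le_right
    rw [Env.res_res] at this ⊢
    refine this ?_
    rw [← Env.res_res hW inf_le_left]
    exact hW₁.mono inf_le_left
  | all F φ ih =>
    intro W hW s
    refine ih (cover_inf hW hc) fun i => ?_
    have := hφ i (W ⊓ c i) inf_le_right (F.res inf_le_left s)
    rw [Env.res_res] at this
    rwa [Env.res_cons, Env.res_res]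
  | ex F φ ih =>
    refine forcesAt_ex.2 <| .of_cover hc fun i => ?_
    simpa only [Env.res_res] using forcesAt_ex.1 (hφ i)

theorem ForcesAt.of_holdsLocally {U V : O} {h : V ≤ U} {φ : OpenFormula.{u, v, w} U Γ}
    {ρ : Env V Γ} {P : (W : O) → W ≤ V → Prop} (hP : HoldsLocally V P)
    (hφ : ∀ W hW, P W hW → ForcesAt φ W (hW.trans h) (ρ.res hW)) : ForcesAt φ V h ρ := by
  obtain ⟨ι, c, hc, hP⟩ := hP
  exact .of_cover hc fun i => hφ _ _ (hP i)

theorem eval_liftSubst {U V : O} (h : V ≤ U) (ρ : Env V Δ) (G : Sheaf.{u, v} O) (s : G.sec V)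
    (σ : (F : Sheaf.{u, v} O) → Var Γ F →
      Term (sheafSignature.{u, v} O) (fun F => F.sec U) Δ F) :
    (fun F v => eval h (ρ.cons s) (liftSubst σ G F v)) =
      Env.cons s (fun F v => eval h ρ (σ F v)) := by
  refine Env.ext_cons rfl fun F v => ?_
  simp only [liftSubst, eval_subst]
  rfl

theorem forcesAt_subst {U V : O} (h : V ≤ U) (φ : OpenFormula.{u, v, w} U Γ)
    (σ : (F : Sheaf.{u, v} O) → Var Γ F →
      Term (sheafSignature.{u, v} O) (fun F => F.sec U) Δ F) (ρ : Env V Δ) :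
    ForcesAt (φ.subst σ) V h ρ ↔ ForcesAt φ V h (fun F v => eval h ρ (σ F v)) := by
  -- The non-atomic clauses move to smaller opens, so evaluating `σ` must commute with restriction.
  have hres {V W : O} (h : V ≤ U) (hW : W ≤ V) {Γ Δ : List (Sheaf.{u, v} O)} (ρ : Env V Δ)
      (σ : (F : Sheaf.{u, v} O) → Var Γ F →
        Term (sheafSignature.{u, v} O) (fun F => F.sec U) Δ F) :
      Env.res hW (fun F v => eval h ρ (σ F v)) =
        fun F v => eval (hW.trans h) (ρ.res hW) (σ F v) := by
    funext F v
    exact res_eval h hW ρ _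
  induction φ generalizing V Δ with
  | eq | rel => simp only [Formula.subst, ForcesAt, eval_subst]
  | top | bot => rfl
  | and φ ψ ih₁ ih₂ | or φ ψ ih₁ ih₂ | imp φ ψ ih₁ ih₂ =>
    simp only [Formula.subst, ForcesAt, ih₁, ih₂, hres]
  | bigAnd φ ih | bigOr φ ih => simp only [Formula.subst, ForcesAt, ih, hres]
  | all F φ ih | ex F φ ih => simp only [Formula.subst, ForcesAt, ih, hres, eval_liftSubst]

theorem forcesAt_weaken {U V : O} (h : V ≤ U) (φ : OpenFormula.{u, v, w} U Γ)
    {G : Sheaf.{u, v} O} (ρ : Env V (G :: Γ)) :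
    ForcesAt (φ.weaken G) V h ρ ↔ ForcesAt φ V h (fun F v => ρ F v.succ) :=
  forcesAt_subst h φ _ ρ

theorem forcesAt_eqConj {U V : O} {h : V ≤ U} {ρ : Env V Γ}
    {τ : (F : Sheaf.{u, v} O) → Var Γ F → Var Γ F}
    {xs : List ((F : Sheaf.{u, v} O) × Var Γ F)}
    (hxs : ForcesAt (eqConj τ xs : OpenFormula.{u, v, w} U Γ) V h ρ)
    {F : Sheaf.{u, v} O} {v : Var Γ F}
    (hv : (⟨F, v⟩ : (F : Sheaf.{u, v} O) × Var Γ F) ∈ xs) : ρ F v = ρ F (τ F v) := by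
  induction xs with
  | nil => simp at hv
  | cons x xs ih =>
    rcases List.mem_cons.1 hv with rfl | hv
    · exact hxs.1
    · exact ih hxs.2 hv

theorem ForcesAt.of_entails {U V : O} {φ ψ : OpenFormula.{u, v, w} U Γ} (hφψ : Entails φ ψ)
    {h : V ≤ U} {ρ : Env V Γ} (hφ : ForcesAt φ V h ρ) : ForcesAt ψ V h ρ := by
  induction hφψ generalizing V with
  | refl => exact hφ
  | cut _ _ ih₁ ih₂ => exact ih₂ (ih₁ hφ)
  | subst σ _ ih => exact (forcesAt_subst ..).2 (ih ((forcesAt_subst ..).1 hφ))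
  | top_intro => trivial
  | and_left => exact hφ.1
  | and_right => exact hφ.2
  | and_intro _ _ ih₁ ih₂ => exact ⟨ih₁ hφ, ih₂ hφ⟩
  | bot_elim =>
    -- The open `⊥` is covered by the empty family, so locality forces every formula there.
    exact .of_cover (ι := PEmpty) (c := PEmpty.elim) (Eq.trans hφ (iSup_of_empty _).symm)
      fun i => i.elim
  | or_left =>
    -- On the trivial covering the environment becomes `ρ.res le_rfl`; `mono le_rfl` accounts for
    -- this.
    exact forcesAt_or.2 (.of_self (.inl (hφ.mono le_rfl)))
  | or_right =>
    exact forcesAt_or.2 (.of_self (.inr (hφ.mono le_rfl)))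
  | or_elim _ _ ih₁ ih₂ =>
    exact .of_holdsLocally (forcesAt_or.1 hφ) fun W hW => Or.rec ih₁ ih₂
  | bigOr_intro φ i => exact forcesAt_bigOr.2 (.of_self ⟨i, hφ.mono le_rfl⟩)
  | bigOr_elim _ ih => exact .of_holdsLocally (forcesAt_bigOr.1 hφ) fun W hW ⟨i, hi⟩ => ih i hi
  | ex_elim _ ih =>
    exact .of_holdsLocally (forcesAt_ex.1 hφ) fun W hW ⟨s, hs⟩ => (forcesAt_weaken ..).1 (ih hs)
  | @ex_elim_inv Γ F φ ψ _ ih =>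
    -- The value of the freed variable is itself a witness, on the trivial covering.
    refine (forcesAt_weaken ..).2 (ih (forcesAt_ex.2 (.of_self ⟨ρ F .zero, ?_⟩)))
    convert hφ using 1
    exact Env.ext_cons rfl fun F v => pres_rfl _ _
  | bigOr_and φ ψ =>
    exact forcesAt_bigOr.2 <| (forcesAt_bigOr.1 hφ.1).imp fun W hW ⟨i, hi⟩ => ⟨i, hi, hφ.2.mono hW⟩
  | ex_and φ ψ =>
    exact forcesAt_ex.2 <| (forcesAt_ex.1 hφ.1).imp fun W hW ⟨s, hs⟩ =>
      ⟨s, hs, (forcesAt_weaken ..).2 (hφ.2.mono hW)⟩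
  | eq_refl => rfl
  | eq_subst τ xs hτ φ =>
    refine (forcesAt_subst ..).2 ?_
    convert hφ.2 using 1
    funext F v
    -- Variables in `xs` have the same value as their replacements by the equations; `τ` fixes all
    -- others.
    by_cases hv : (⟨F, v⟩ : (F : Sheaf.{u, v} O) × Var _ F) ∈ xs
    · exact (forcesAt_eqConj hφ.1 hv).symm
    · exact congrArg (ρ F) (hτ F v hv)
  | bigAnd_elim φ i => exact hφ i
  | bigAnd_intro _ ih => exact fun i => ih i hφ
  | imp_intro _ ih => exact fun W hW hψ => ih ⟨hφ.mono hW, hψ⟩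
  | imp_elim _ ih =>
    have := ih hφ.1 V le_rfl
    rw [Env.res_rfl] at this
    exact this hφ.2
  | all_intro _ ih => exact fun W hW s => ih ((forcesAt_weaken ..).2 (hφ.mono hW))
  | @all_elim Γ F φ ψ _ ih =>
    convert ih ((forcesAt_weaken ..).1 hφ) V le_rfl (ρ F .zero) using 1
    exact Env.ext_cons rfl fun F v => (pres_rfl _ _).symm

theorem forces_restrict {U V : O} (h : V ≤ U) (φ : FormulaOver.{u, v, w} U) :
    Forces V (φ.restrict h) ↔ ForcesAt φ V h Env.nil :=
  forcesAt_restrict h le_rfl φ _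

theorem Forces.restrict {U V : O} {φ : FormulaOver.{u, v, w} U} (hφ : Forces U φ) (h : V ≤ U) :
    Forces V (φ.restrict h) :=
  (forces_restrict h φ).2 (Env.eq_nil (Env.nil.res h) ▸ hφ.mono h)

theorem Forces.of_cover {U : O} {φ : FormulaOver.{u, v, w} U} {ι : Type x} {c : ι → O}
    (hc : U = ⨆ i, c i) (hφ : ∀ i, Forces (c i) (φ.restrict (le_of_cover hc i))) :
    Forces U φ := by
  -- The index type `ι` may live in any universe; the set of opens that it hits lies in `Type u`, as
  -- the forcing clauses require.
  refine ForcesAt.of_cover (ι := Set.range c) (c := Subtype.val) (hc.trans (sSup_eq_iSup' _)) ?_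
  rintro ⟨_, i, rfl⟩
  rw [Env.eq_nil (Env.res _ _)]
  exact (forces_restrict _ φ).1 (hφ i)

end Semantics

end LocaleSheaf

theorem mainTheorem4 (X : Locale.{u}) (U : X) (φ : LocaleSheaf.FormulaOver.{u, v, w} U) :
    -- monotonicity
    (∀ (V : X) (h : V ≤ U), LocaleSheaf.Forces U φ → LocaleSheaf.Forces V (φ.restrict h)) ∧
    -- locality
    (∀ (ι : Type x) (c : ι → X) (hc : U = ⨆ i, c i),
      (∀ i, LocaleSheaf.Forces (c i) (φ.restrict (LocaleSheaf.le_of_cover hc i))) →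
        LocaleSheaf.Forces U φ) ∧
    -- soundness for infinitary intuitionistic first-order logic
    (∀ ψ : LocaleSheaf.FormulaOver.{u, v, w} U,
      LocaleSheaf.Forces U φ → InfLogic.Entails φ ψ → LocaleSheaf.Forces U ψ) :=
  ⟨fun _ h hφ => hφ.restrict h, fun _ _ hc hφ => .of_cover hc hφ,
    fun _ hφ hφψ => LocaleSheaf.ForcesAt.of_entails hφψ hφ⟩
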